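/- Let $n$ be a natural number and let $P$ be a non-empty finite set of primes. For $1\le r\le s\le n$ and $q\in\mathbb{Q}\setminus\{0\}$ let $\theta_{rs}(q)$ be the $n\times n$ matrix whose $(r,s)$ entry is $q$ and which agrees with the identity matrix everywhere else. Let $$K_P=\{\theta_{rs}(1)^{\pm1}: 1\le r<s\le n\}\cup\{\theta_{rr}(p)^{\pm1}: p\in P,\ 1\le r\le n\},$$ let $FG_n(P)$ be the subgroup of $GL_n(\mathbb{Q})$ generated by $K_P$, and let $|f|$ denote the word length of $f\in FG_n(P)$ with respect to $K_P$. For a prime $p$ and $v\in\mathbb{Q}_p^n$ let $|v|_p=\max_i|v_i|_p$, and for $v\in\mathbb{R}^n$ let $|v|_\infty$ be the Euclidean norm. For $f\in GL_n(\mathbb{Q})$ and $p$ a prime or $\infty$ let $\|f\|_p=\sup_{|v|_p=1}|fv|_p$ be the operator norm ($v\in\mathbb{Q}_p^n$, respectively $v\in\mathbb{R}^n$ if $p=\infty$), and let $$\ell_a(f)=\sum_{p\ \text{prime or}\ \infty}\left(\ln^+\|f\|_p+\ln^+\|f^{-1}\|_p\right)$$ be the adelic length, where $\ln^+$ is the positive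 part of the natural logarithm (only finitely many terms of the sum are non-zero). Then there are positive real constants $Q,R,S,T$, depending only on $n$ and $P$, such that for every $f\in FG_n(P)$ $$|f|\le S+T\,\ell_a(f),$$ and for every $f\in FG_n(P)$ other than the identity $$Q+R\,\ell_a(f)\le|f|.$$ -/

import Mathlib

namespace AdelicWord

/-- The matrix `θ_{rs}(q)`: it has the entry `q` at position `(r, s)` and agrees with the identity
matrix everywhere else. -/
def theta {n : ℕ} (r s : Fin n) (q : ℚ) : Matrix (Fin n) (Fin n) ℚ :=
  Matrix.of fun i j => if (r, s) = (i, j) then q else if i = j then 1 else 0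

theorem theta_det_ne_zero {n : ℕ} {r s : Fin n} (hrs : r ≤ s) {q : ℚ} (hq : q ≠ 0) :
    (theta r s q).det ≠ 0 := by
  have htri : (theta r s q).BlockTriangular id := by
    intro i j hij
    simp only [id] at hij
    have h1 : ¬ ((r, s) = (i, j)) := by
      intro h
      obtain ⟨rfl, rfl⟩ := Prod.mk.inj h
      exact absurd hij (not_lt.mpr hrs)
    simp only [theta, Matrix.of_apply, if_neg h1, if_neg hij.ne']
  rw [Matrix.det_of_isUpperTriangular htri, Finset.prod_ne_zero_iff]
  intro i _
  simp only [theta, Matrix.of_apply]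
  split_ifs <;> simp_all

/-- The matrix `θ_{rs}(q)`, for `r ≤ s` and `q ≠ 0`, as an element of `GL_n(ℚ)`. -/
noncomputable def thetaGL {n : ℕ} (r s : Fin n) (hrs : r ≤ s) (q : ℚ) (hq : q ≠ 0) :
    GL (Fin n) ℚ :=
  Matrix.GeneralLinearGroup.mkOfDetNeZero (theta r s q) (theta_det_ne_zero hrs hq)

theorem prime_cast_ne_zero (p : Nat.Primes) : ((p : ℕ) : ℚ) ≠ 0 :=
  Nat.cast_ne_zero.mpr p.2.ne_zero

/-- The unipotent generators `θ_{rs}(1)^{±1}`, `r < s`. -/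
def unipotentGens (n : ℕ) : Set (GL (Fin n) ℚ) :=
  {g | ∃ (r s : Fin n) (h : r < s),
    g = thetaGL r s h.le 1 one_ne_zero ∨ g = (thetaGL r s h.le 1 one_ne_zero)⁻¹}

/-- The diagonal generators `θ_{rr}(p)^{±1}`, `p ∈ P`. -/
def diagonalGens (n : ℕ) (P : Finset Nat.Primes) : Set (GL (Fin n) ℚ) :=
  {g | ∃ (r : Fin n), ∃ p ∈ P,
    g = thetaGL r r le_rfl (p : ℕ) (prime_cast_ne_zero p) ∨
      g = (thetaGL r r le_rfl (p : ℕ) (prime_cast_ne_zero p))⁻¹}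

/-- The symmetric generating set `K_P`. -/
def gens (n : ℕ) (P : Finset Nat.Primes) : Set (GL (Fin n) ℚ) :=
  unipotentGens n ∪ diagonalGens n P

/-- The group `FG_n(P)`, the subgroup of `GL_n(ℚ)` generated by `K_P`. -/
def FG (n : ℕ) (P : Finset Nat.Primes) : Subgroup (GL (Fin n) ℚ) :=
  Subgroup.closure (gens n P)

/-- The word length of an element of `FG_n(P)` with respect to `K_P`: the least length of a list of
elements of `K_P` whose product is that element. -/
noncomputable def wordLength {n : ℕ} {P : Finset Nat.Primes} (f : FG n P) : ℕ :=
  sInf {k | ∃ l : List (GL (Fin n) ℚ),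
    (∀ g ∈ l, g ∈ gens n P) ∧ l.prod = (f : GL (Fin n) ℚ) ∧ l.length = k}

theorem gens_inv {n : ℕ} {P : Finset Nat.Primes} {g : GL (Fin n) ℚ} (hg : g ∈ gens n P) :
    g⁻¹ ∈ gens n P := by
  rcases hg with ⟨r, s, h, rfl | rfl⟩ | ⟨r, p, hp, rfl | rfl⟩
  · exact Or.inl ⟨r, s, h, Or.inr rfl⟩
  · exact Or.inl ⟨r, s, h, Or.inl (inv_inv _)⟩
  · exact Or.inr ⟨r, p, hp, Or.inr rfl⟩
  · exact Or.inr ⟨r, p, hp, Or.inl (inv_inv _)⟩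

/-- The set of which `wordLength` is the minimum is never empty. -/
theorem exists_word {n : ℕ} {P : Finset Nat.Primes} (f : FG n P) :
    ∃ l : List (GL (Fin n) ℚ),
      (∀ g ∈ l, g ∈ gens n P) ∧ l.prod = (f : GL (Fin n) ℚ) := by
  have hf : (f : GL (Fin n) ℚ) ∈ Submonoid.closure (gens n P ∪ (gens n P)⁻¹) := by
    rw [← Subgroup.closure_toSubmonoid]
    exact f.2
  obtain ⟨l, hl, hprod⟩ := Submonoid.exists_list_of_mem_closure hf
  refine ⟨l, fun g hg => ?_, hprod⟩
  rcases hl g hg with h | h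
  · exact h
  · simpa using gens_inv h

instance primesFact (p : Nat.Primes) : Fact (p : ℕ).Prime := ⟨p.2⟩

/-- The `p`-adic operator norm `sup {|fv|_p : |v|_p = 1}` of a rational matrix acting on `ℚ_p ^ n`.
The norm of `Fin n → ℚ_[p]` is the maximum of the `p`-adic absolute values of the coordinates. -/
noncomputable def padicOpNorm {n : ℕ} (p : Nat.Primes) (f : Matrix (Fin n) (Fin n) ℚ) : ℝ :=
  sSup {x | ∃ v : Fin n → ℚ_[p], ‖v‖ = 1 ∧
    x = ‖(f.map (fun q : ℚ => (q : ℚ_[p]))).mulVec v‖}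

/-- The real operator norm `sup {|fv| : |v| = 1}` of a rational matrix for the Euclidean norm on
`ℝ ^ n` (the spectral norm). -/
noncomputable def realOpNorm {n : ℕ} (f : Matrix (Fin n) (Fin n) ℚ) : ℝ :=
  sSup {x | ∃ v : EuclideanSpace ℝ (Fin n), ‖v‖ = 1 ∧
    x = ‖WithLp.toLp 2 ((f.map (fun q : ℚ => (q : ℝ))).mulVec v.ofLp)‖}

/-- The summand of the adelic length at the prime `p`. -/
noncomputable def padicTerm {n : ℕ} (p : Nat.Primes) (f : GL (Fin n) ℚ) : ℝ :=
  Real.posLog (padicOpNorm p (f : Matrix (Fin n) (Fin n) ℚ)) +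
    Real.posLog (padicOpNorm p ((f⁻¹ : GL (Fin n) ℚ) : Matrix (Fin n) (Fin n) ℚ))

/-- The summand of the adelic length at the place `∞`. -/
noncomputable def realTerm {n : ℕ} (f : GL (Fin n) ℚ) : ℝ :=
  Real.posLog (realOpNorm (f : Matrix (Fin n) (Fin n) ℚ)) +
    Real.posLog (realOpNorm ((f⁻¹ : GL (Fin n) ℚ) : Matrix (Fin n) (Fin n) ℚ))

/-- The adelic length of an element of `GL_n(ℚ)`, the sum over all primes and `∞`. -/
noncomputable def adelicLength {n : ℕ} (f : GL (Fin n) ℚ) : ℝ :=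
  (∑' p : Nat.Primes, padicTerm p f) + realTerm f

/-- The supremum in `padicOpNorm` is taken over a bounded set; every bound of the entries is a
bound. -/
theorem padicOpNorm_bound {n : ℕ} (p : Nat.Primes) (f : Matrix (Fin n) (Fin n) ℚ) {C : ℝ}
    (hC : 0 ≤ C) (h : ∀ i j, ‖((f i j : ℚ) : ℚ_[p])‖ ≤ C) :
    C ∈ upperBounds {x | ∃ v : Fin n → ℚ_[p], ‖v‖ = 1 ∧
      x = ‖(f.map (fun q : ℚ => (q : ℚ_[p]))).mulVec v‖} := by
  rintro x ⟨v, hv, rfl⟩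
  rw [pi_norm_le_iff_of_nonneg hC]
  intro i
  change ‖∑ j, (f.map (fun q : ℚ => (q : ℚ_[p]))) i j * v j‖ ≤ C
  refine IsUltrametricDist.norm_sum_le_of_forall_le_of_nonneg hC fun j _ => ?_
  rw [Matrix.map_apply, norm_mul]
  have h1 : ‖v j‖ ≤ 1 := hv ▸ norm_le_pi_norm v j
  calc _ ≤ C * 1 := mul_le_mul (h i j) h1 (norm_nonneg _) hC
    _ = C := mul_one C

theorem padicOpNorm_bddAbove {n : ℕ} (p : Nat.Primes) (f : Matrix (Fin n) (Fin n) ℚ) :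
    BddAbove {x | ∃ v : Fin n → ℚ_[p], ‖v‖ = 1 ∧
      x = ‖(f.map (fun q : ℚ => (q : ℚ_[p]))).mulVec v‖} := by
  refine ⟨∑ i, ∑ j, ‖((f i j : ℚ) : ℚ_[p])‖, padicOpNorm_bound p f (by positivity) ?_⟩
  intro i j
  calc _ ≤ ∑ j, ‖((f i j : ℚ) : ℚ_[p])‖ :=
        Finset.single_le_sum (f := fun j => ‖((f i j : ℚ) : ℚ_[p])‖)
          (fun _ _ => norm_nonneg _) (Finset.mem_univ j)
    _ ≤ _ := Finset.single_le_sum (f := fun i => ∑ j, ‖((f i j : ℚ) : ℚ_[p])‖)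
          (fun _ _ => by positivity) (Finset.mem_univ i)

/-- The supremum in `realOpNorm` is taken over a bounded set. -/
theorem realOpNorm_bddAbove {n : ℕ} (f : Matrix (Fin n) (Fin n) ℚ) :
    BddAbove {x | ∃ v : EuclideanSpace ℝ (Fin n), ‖v‖ = 1 ∧
      x = ‖WithLp.toLp 2 ((f.map (fun q : ℚ => (q : ℝ))).mulVec v.ofLp)‖} := by
  refine ⟨‖Matrix.toEuclideanCLM (𝕜 := ℝ) (f.map (fun q : ℚ => (q : ℝ)))‖, ?_⟩
  rintro x ⟨v, hv, rfl⟩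
  have h := (Matrix.toEuclideanCLM (𝕜 := ℝ) (f.map (fun q : ℚ => (q : ℝ)))).le_opNorm v
  rw [hv, mul_one] at h
  exact h

/-- Only finitely many primes divide a denominator of an entry of a rational matrix. -/
theorem posLog_padicOpNorm_finite {n : ℕ} (f : Matrix (Fin n) (Fin n) ℚ) :
    {p : Nat.Primes | Real.posLog (padicOpNorm p f) ≠ 0}.Finite := by
  have hfin : (⋃ (i : Fin n) (j : Fin n), {p : Nat.Primes | (p : ℕ) ∣ (f i j).den}).Finite := by
    refine Set.finite_iUnion fun i => Set.finite_iUnion fun j => ?_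
    refine Set.Finite.preimage (f := fun p : Nat.Primes => (p : ℕ))
      (Subtype.val_injective.injOn) ?_ (s := {m | m ∣ (f i j).den})
    exact (Set.finite_le_nat (f i j).den).subset fun m hm => Nat.le_of_dvd (f i j).pos hm
  refine hfin.subset fun p hp => ?_
  by_contra hmem
  simp only [Set.mem_iUnion, Set.mem_ofPred_eq, not_exists] at hmem
  refine hp ?_
  rw [Real.posLog_eq_zero_iff]
  have hb := padicOpNorm_bound p f zero_le_one fun i j => Padic.norm_rat_le_one (hmem i j)
  have h1 : padicOpNorm p f ≤ 1 := Real.sSup_le hb zero_le_one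
  have h0 : 0 ≤ padicOpNorm p f := Real.sSup_nonneg (by rintro x ⟨v, -, rfl⟩; positivity)
  rw [abs_of_nonneg h0]
  exact h1

/-- The sum defining the adelic length has only finitely many nonzero terms. -/
theorem padicTerm_finite_support {n : ℕ} (f : GL (Fin n) ℚ) :
    (Function.support fun p : Nat.Primes => padicTerm p f).Finite := by
  refine ((posLog_padicOpNorm_finite (f : Matrix (Fin n) (Fin n) ℚ)).union
    (posLog_padicOpNorm_finite ((f⁻¹ : GL (Fin n) ℚ) : Matrix (Fin n) (Fin n) ℚ))).subset ?_
  intro p hp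
  by_contra hmem
  simp only [Set.mem_union, Set.mem_ofPred_eq, not_or, not_not] at hmem
  exact hp (by simp only [padicTerm]; rw [hmem.1, hmem.2, add_zero])

theorem padicTerm_summable {n : ℕ} (f : GL (Fin n) ℚ) :
    Summable fun p : Nat.Primes => padicTerm p f :=
  summable_of_hasFiniteSupport (padicTerm_finite_support f)

end AdelicWord

namespace AdelicWord

/-! ### Operator norms and the adelic length -/

/-! Lower bound: operator norms are submultiplicative, so `adelicLength` is subadditive and each of
the finitely many generators adds a bounded amount (`exists_adelicLength_le_mul_wordLength`).

Upper bound: an element of `FG n P` is upper triangular over ℤ[1/P] with positive units on the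
diagonal (`IsTriangular.coe`). The numerator and denominator of each entry have logarithm at most
`adelicLength f`. The matrix is a product of at most n² elementary matrices whose parameters are
entries of `f` itself (`HasWord.of_entries`), so each factor only has to be written with O(1 + ℓ_a)
letters. Diagonal factors are split into primes. Off the diagonal, conjugation by the denominator
leaves an integer parameter `a`, and Horner's scheme in one base `p ∈ P` takes O(1 + log |a|)
letters, because conjugation by `θ_{rr}(p)` multiplies the parameter by `p`. -/

theorem padicOpNorm_nonneg {n : ℕ} (p : Nat.Primes) (f : Matrix (Fin n) (Fin n) ℚ) :
    0 ≤ padicOpNorm p f :=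
  Real.sSup_nonneg (by rintro x ⟨v, -, rfl⟩; positivity)

theorem norm_entry_le_padicOpNorm {n : ℕ} (p : Nat.Primes) (f : Matrix (Fin n) (Fin n) ℚ)
    (i j : Fin n) : ‖((f i j : ℚ) : ℚ_[p])‖ ≤ padicOpNorm p f := by
  have h1 : ‖(Pi.single j 1 : Fin n → ℚ_[p])‖ = 1 := by
    rw [Pi.norm_single, norm_one]
  refine le_trans ?_ (le_csSup (padicOpNorm_bddAbove p f) ⟨Pi.single j 1, h1, rfl⟩)
  refine le_trans (le_of_eq ?_) (norm_le_pi_norm _ i)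
  rw [Matrix.mulVec_single_one, Matrix.col_apply, Matrix.map_apply]

/-- By the ultrametric inequality a bound on the entries bounds the operator norm, so it suffices to
estimate the entries of the product. -/
theorem padicOpNorm_mul_le {n : ℕ} (p : Nat.Primes) (f g : Matrix (Fin n) (Fin n) ℚ) :
    padicOpNorm p (f * g) ≤ padicOpNorm p f * padicOpNorm p g := by
  have h0 := mul_nonneg (padicOpNorm_nonneg p f) (padicOpNorm_nonneg p g)
  refine Real.sSup_le (padicOpNorm_bound p _ h0 fun i j => ?_) h0
  rw [Matrix.mul_apply, Rat.cast_sum]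
  refine IsUltrametricDist.norm_sum_le_of_forall_le_of_nonneg h0 fun k _ => ?_
  rw [Rat.cast_mul, norm_mul]
  exact mul_le_mul (norm_entry_le_padicOpNorm p f i k) (norm_entry_le_padicOpNorm p g k j)
    (norm_nonneg _) (padicOpNorm_nonneg p f)

theorem realOpNorm_nonneg {n : ℕ} (f : Matrix (Fin n) (Fin n) ℚ) : 0 ≤ realOpNorm f :=
  Real.sSup_nonneg (by rintro x ⟨v, -, rfl⟩; positivity)

/-- Submultiplicativity then comes from that of the operator norm, since the cast to ℝ and
`toEuclideanCLM` are multiplicative. -/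
theorem realOpNorm_eq_norm {n : ℕ} (f : Matrix (Fin n) (Fin n) ℚ) :
    realOpNorm f = ‖Matrix.toEuclideanCLM (𝕜 := ℝ) (f.map (Rat.castHom ℝ))‖ := by
  apply le_antisymm
  · refine Real.sSup_le ?_ (norm_nonneg _)
    rintro x ⟨v, hv, rfl⟩
    have h := (Matrix.toEuclideanCLM (𝕜 := ℝ) (f.map (Rat.castHom ℝ))).le_opNorm v
    rw [hv, mul_one] at h
    exact h
  · exact ContinuousLinearMap.opNorm_le_of_unit_norm (realOpNorm_nonneg f) fun x hx =>
      le_csSup (realOpNorm_bddAbove f) ⟨x, hx, rfl⟩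

theorem realOpNorm_mul_le {n : ℕ} (f g : Matrix (Fin n) (Fin n) ℚ) :
    realOpNorm (f * g) ≤ realOpNorm f * realOpNorm g := by
  simp only [realOpNorm_eq_norm, Matrix.map_mul, map_mul]
  exact norm_mul_le _ _

theorem abs_entry_le_realOpNorm {n : ℕ} (f : Matrix (Fin n) (Fin n) ℚ) (i j : Fin n) :
    |((f i j : ℚ) : ℝ)| ≤ realOpNorm f := by
  have h1 : ‖(EuclideanSpace.single j 1 : EuclideanSpace ℝ (Fin n))‖ = 1 := by simp
  refine le_trans ?_ (le_csSup (realOpNorm_bddAbove f) ⟨_, h1, rfl⟩)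
  refine le_trans (le_of_eq ?_) (PiLp.norm_apply_le _ i)
  simp only [Matrix.mulVec_single_one, PiLp.ofLp_single, Matrix.col_apply,
    Matrix.map_apply, Real.norm_eq_abs]

theorem posLog_le_add_of_le_mul {a b c : ℝ} (ha : 0 ≤ a) (h : a ≤ b * c) :
    Real.posLog a ≤ Real.posLog b + Real.posLog c :=
  (Real.posLog_le_posLog ha h).trans Real.posLog_mul

theorem padicTerm_nonneg {n : ℕ} (p : Nat.Primes) (f : GL (Fin n) ℚ) : 0 ≤ padicTerm p f :=
  add_nonneg Real.posLog_nonneg Real.posLog_nonneg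

theorem realTerm_nonneg {n : ℕ} (f : GL (Fin n) ℚ) : 0 ≤ realTerm f :=
  add_nonneg Real.posLog_nonneg Real.posLog_nonneg

theorem adelicLength_nonneg {n : ℕ} (f : GL (Fin n) ℚ) : 0 ≤ adelicLength f :=
  add_nonneg (tsum_nonneg fun p => padicTerm_nonneg p f) (realTerm_nonneg f)

theorem padicTerm_mul_le {n : ℕ} (p : Nat.Primes) (f g : GL (Fin n) ℚ) :
    padicTerm p (f * g) ≤ padicTerm p f + padicTerm p g := by
  have h1 := posLog_le_add_of_le_mul (padicOpNorm_nonneg p _) (padicOpNorm_mul_le p f.1 g.1)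
  have h2 := posLog_le_add_of_le_mul (padicOpNorm_nonneg p _) (padicOpNorm_mul_le p g⁻¹.1 f⁻¹.1)
  simp only [padicTerm, mul_inv_rev, Units.val_mul]
  linarith

theorem realTerm_mul_le {n : ℕ} (f g : GL (Fin n) ℚ) :
    realTerm (f * g) ≤ realTerm f + realTerm g := by
  have h1 := posLog_le_add_of_le_mul (realOpNorm_nonneg _) (realOpNorm_mul_le f.1 g.1)
  have h2 := posLog_le_add_of_le_mul (realOpNorm_nonneg _) (realOpNorm_mul_le g⁻¹.1 f⁻¹.1)
  simp only [realTerm, mul_inv_rev, Units.val_mul]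
  linarith

theorem adelicLength_mul_le {n : ℕ} (f g : GL (Fin n) ℚ) :
    adelicLength (f * g) ≤ adelicLength f + adelicLength g := by
  have h1 := (padicTerm_summable (f * g)).tsum_le_tsum (fun p => padicTerm_mul_le p f g)
    ((padicTerm_summable f).add (padicTerm_summable g))
  rw [(padicTerm_summable f).tsum_add (padicTerm_summable g)] at h1
  have h2 := realTerm_mul_le f g
  simp only [adelicLength]
  linarith

theorem adelicLength_list_prod_le {n : ℕ} {C : ℝ} (l : List (GL (Fin n) ℚ))
    (h : ∀ g ∈ l, adelicLength g ≤ C) :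
    adelicLength l.prod ≤ adelicLength (1 : GL (Fin n) ℚ) + C * l.length := by
  induction l with
  | nil => simp
  | cons g l ih =>
    have h1 := ih fun x hx => h x (List.mem_cons_of_mem _ hx)
    have h2 := h g List.mem_cons_self
    have h3 := adelicLength_mul_le g l.prod
    simp only [List.prod_cons, List.length_cons, Nat.cast_add, Nat.cast_one]
    linarith

/-! ### The lower bound -/

theorem gens_finite (n : ℕ) (P : Finset Nat.Primes) : (gens n P).Finite := by
  refine Set.Finite.union ?_ ?_
  · refine (Set.finite_iUnion fun r : Fin n => Set.finite_iUnion fun s : Fin n =>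
      Set.finite_iUnion fun h : r < s => Set.toFinite
        ({thetaGL r s h.le 1 one_ne_zero, (thetaGL r s h.le 1 one_ne_zero)⁻¹} :
          Set (GL (Fin n) ℚ))).subset ?_
    rintro g ⟨r, s, h, hg⟩
    simp only [Set.mem_iUnion]
    exact ⟨r, s, h, hg⟩
  · refine (Set.finite_iUnion fun r : Fin n => P.finite_toSet.biUnion fun p _ => Set.toFinite
      ({thetaGL r r le_rfl (p : ℕ) (prime_cast_ne_zero p),
        (thetaGL r r le_rfl (p : ℕ) (prime_cast_ne_zero p))⁻¹} : Set (GL (Fin n) ℚ))).subset ?_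
    rintro g ⟨r, p, hp, hg⟩
    simp only [Set.mem_iUnion]
    exact ⟨r, p, hp, hg⟩

theorem exists_shortest_word {n : ℕ} {P : Finset Nat.Primes} (f : FG n P) :
    ∃ l : List (GL (Fin n) ℚ),
      (∀ g ∈ l, g ∈ gens n P) ∧ l.prod = (f : GL (Fin n) ℚ) ∧ l.length = wordLength f := by
  obtain ⟨l, hl, hprod⟩ := exists_word f
  exact Nat.sInf_mem (s := {k | ∃ l : List (GL (Fin n) ℚ),
    (∀ g ∈ l, g ∈ gens n P) ∧ l.prod = (f : GL (Fin n) ℚ) ∧ l.length = k})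
    ⟨l.length, l, hl, hprod, rfl⟩

theorem exists_adelicLength_le_mul_wordLength (n : ℕ) (P : Finset Nat.Primes) :
    ∃ C : ℝ, 0 < C ∧ ∀ f : FG n P, f ≠ 1 →
      1 ≤ (wordLength f : ℝ) ∧ adelicLength (f : GL (Fin n) ℚ) ≤ C * wordLength f := by
  obtain ⟨B, hB⟩ := ((gens_finite n P).image adelicLength).bddAbove
  -- `|B|` bounds the cost of a letter, `adelicLength 1` is absorbed because a nonempty word has at
  -- least one letter, and `1` makes the constant positive.
  refine ⟨adelicLength (1 : GL (Fin n) ℚ) + |B| + 1, ?_, fun f hf => ?_⟩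
  · have := adelicLength_nonneg (1 : GL (Fin n) ℚ)
    positivity
  obtain ⟨l, hl, hprod, hlen⟩ := exists_shortest_word f
  have hlen1 : 1 ≤ wordLength f := by
    rw [Nat.one_le_iff_ne_zero, ← hlen]
    intro h0
    rw [List.length_eq_zero_iff] at h0
    subst h0
    exact hf (Subtype.ext hprod.symm)
  have hlen2 : (1 : ℝ) ≤ wordLength f := by exact_mod_cast hlen1
  refine ⟨hlen2, ?_⟩
  have h1 := adelicLength_list_prod_le (C := |B|) l fun g hg =>
    (hB ⟨g, hl g hg, rfl⟩).trans (le_abs_self B)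
  rw [hprod, hlen] at h1
  have h2 := adelicLength_nonneg (1 : GL (Fin n) ℚ)
  nlinarith

/-! ### Denominators and numerators of the entries -/

/-- In lowest terms `p` does not divide the numerator, so the norm is exactly `p` to its
multiplicity in the denominator. -/
theorem factorization_mul_log_le_posLog_norm (q : ℚ) (p : Nat.Primes) (hp : (p : ℕ) ∣ q.den) :
    (q.den.factorization p : ℝ) * Real.log (p : ℕ) ≤ Real.posLog ‖(q : ℚ_[p])‖ := by
  have hnum : ‖((q.num : ℤ) : ℚ_[p])‖ = 1 := by
    rw [Padic.norm_intCast_eq_one_iff, Int.isCoprime_iff_gcd_eq_one]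
    exact Nat.Coprime.coprime_dvd_right hp q.reduced
  have hden : ‖((q.den : ℕ) : ℚ_[p])‖ = ((p : ℕ) : ℝ) ^ (-(q.den.factorization p : ℤ)) := by
    conv_lhs => rw [← Nat.ordProj_mul_ordCompl_eq_self q.den p]
    rw [Nat.cast_mul, norm_mul, Nat.cast_pow, Padic.norm_p_pow,
      Padic.norm_natCast_eq_one_iff.mpr (Nat.coprime_ordCompl p.2 q.den_nz), mul_one]
  have hq : ‖(q : ℚ_[p])‖ = ((p : ℕ) : ℝ) ^ (q.den.factorization p) := by
    conv_lhs => rw [← Rat.num_div_den q]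
    rw [Rat.cast_div, Rat.cast_intCast, Rat.cast_natCast, norm_div, hnum, hden, zpow_neg,
      zpow_natCast, one_div, inv_inv]
  rw [hq, ← Real.log_pow]
  exact le_max_right _ _

/-- The finite places control the denominator and the real place the absolute value. The two are
kept in one sum because the numerator is the denominator times the absolute value. -/
theorem log_den_add_posLog_le_adelicLength {n : ℕ} (f : GL (Fin n) ℚ) (i j : Fin n) :
    Real.log ((f.1 i j).den : ℕ) + Real.posLog |((f.1 i j : ℚ) : ℝ)| ≤ adelicLength f := by
  set q := f.1 i j with hq
  refine add_le_add ?_ ?_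
  · rw [Real.log_nat_eq_sum_factorization]
    simp only [Finsupp.sum, Nat.support_factorization]
    rw [← Finset.sum_subtype_of_mem (p := Nat.Prime) _ fun x hx => Nat.prime_of_mem_primeFactors hx]
    refine le_trans (Finset.sum_le_sum (g := fun p : Nat.Primes => padicTerm p f) fun p hp => ?_)
      (Summable.sum_le_tsum (f := fun p : Nat.Primes => padicTerm p f) _
        (fun p _ => padicTerm_nonneg p f) (padicTerm_summable f))
    have hp' : (p : ℕ) ∈ q.den.primeFactors := Finset.mem_subtype.mp hp
    refine (factorization_mul_log_le_posLog_norm q p (Nat.dvd_of_mem_primeFactors hp')).trans ?_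
    refine (Real.posLog_le_posLog (norm_nonneg _) (norm_entry_le_padicOpNorm p f.1 i j)).trans ?_
    exact le_add_of_nonneg_right Real.posLog_nonneg
  · refine (Real.posLog_le_posLog (abs_nonneg _) (abs_entry_le_realOpNorm f.1 i j)).trans ?_
    exact le_add_of_nonneg_right Real.posLog_nonneg

theorem log_den_le_adelicLength {n : ℕ} (f : GL (Fin n) ℚ) (i j : Fin n) :
    Real.log ((f.1 i j).den : ℕ) ≤ adelicLength f :=
  (le_add_of_nonneg_right Real.posLog_nonneg).trans (log_den_add_posLog_le_adelicLength f i j)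

theorem log_natAbs_num_le_adelicLength {n : ℕ} (f : GL (Fin n) ℚ) (i j : Fin n) :
    Real.log ((f.1 i j).num.natAbs : ℕ) ≤ adelicLength f := by
  refine le_trans ?_ (log_den_add_posLog_le_adelicLength f i j)
  generalize f.1 i j = q
  rcases eq_or_ne q 0 with rfl | hq
  · simp
  have hd : (0 : ℝ) < (q.den : ℕ) := by exact_mod_cast q.pos
  have h : ((q.num.natAbs : ℕ) : ℝ) = (q.den : ℝ) * |(q : ℝ)| := by
    rw [Nat.cast_natAbs, Int.cast_abs, Rat.cast_def, abs_div, abs_of_pos hd]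
    field_simp
  rw [h, Real.log_mul hd.ne' (by simpa using hq)]
  exact add_le_add_right (le_max_right _ _) _

/-! ### Elementary matrices -/

theorem theta_apply {n : ℕ} (r s i j : Fin n) (q : ℚ) :
    theta r s q i j = if r = i ∧ s = j then q else if i = j then 1 else 0 := by
  simp only [theta, Matrix.of_apply, Prod.mk.injEq]

theorem theta_eq_transvection {n : ℕ} {r s : Fin n} (h : r ≠ s) (q : ℚ) :
    theta r s q = Matrix.transvection r s q := by
  ext i j
  simp only [theta_apply, Matrix.transvection, Matrix.add_apply, Matrix.one_apply,
    Matrix.single_apply]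
  grind

theorem theta_self_eq_diagonal {n : ℕ} (r : Fin n) (q : ℚ) :
    theta r r q = Matrix.diagonal (fun i => if i = r then q else 1) := by
  ext i j
  simp only [theta_apply, Matrix.diagonal_apply]
  grind

theorem theta_zero {n : ℕ} {r s : Fin n} (h : r ≠ s) : theta r s 0 = 1 := by
  rw [theta_eq_transvection h, Matrix.transvection_zero]

theorem theta_self_one {n : ℕ} (r : Fin n) : theta r r 1 = 1 := by
  simp [theta_self_eq_diagonal]

theorem theta_mul_theta {n : ℕ} {r s : Fin n} (h : r ≠ s) (a b : ℚ) :
    theta r s a * theta r s b = theta r s (a + b) := by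
  simp only [theta_eq_transvection h, Matrix.transvection_mul_transvection_same r s h]

theorem theta_self_mul_theta_self {n : ℕ} (r : Fin n) (a b : ℚ) :
    theta r r a * theta r r b = theta r r (a * b) := by
  simp only [theta_self_eq_diagonal, Matrix.diagonal_mul_diagonal]
  congr 1
  ext i
  split_ifs <;> simp

/-- This relation drives both the Horner step (`a` a prime) and the clearing of denominators (`a`
the denominator). -/
theorem theta_self_mul_theta {n : ℕ} {r s : Fin n} (h : r ≠ s) (a b : ℚ) :
    theta r r a * theta r s b = theta r s (a * b) * theta r r a := by
  rw [theta_self_eq_diagonal]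
  ext i j
  rw [Matrix.diagonal_mul, Matrix.mul_diagonal, theta_apply, theta_apply]
  split_ifs <;> grind

theorem theta_self_inv {n : ℕ} (r : Fin n) {a : ℚ} (ha : a ≠ 0) :
    (theta r r a)⁻¹ = theta r r a⁻¹ := by
  apply Matrix.inv_eq_right_inv
  rw [theta_self_mul_theta_self, mul_inv_cancel₀ ha, theta_self_one]

theorem theta_inv {n : ℕ} {r s : Fin n} (h : r ≠ s) (a : ℚ) :
    (theta r s a)⁻¹ = theta r s (-a) := by
  apply Matrix.inv_eq_right_inv
  rw [theta_mul_theta h, add_neg_cancel, theta_zero h]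

theorem coe_thetaGL {n : ℕ} (r s : Fin n) (hrs : r ≤ s) (q : ℚ) (hq : q ≠ 0) :
    (thetaGL r s hrs q hq : Matrix (Fin n) (Fin n) ℚ) = theta r s q := rfl

/-- Left multiplication by an elementary matrix fills in one entry, if the row that is added
is a row of the identity matrix. -/
theorem theta_mul_apply_of_row_eq_one {n : ℕ} (i k : Fin n) (q : ℚ) (g : Matrix (Fin n) (Fin n) ℚ)
    (hrow : ∀ b, g k b = (1 : Matrix (Fin n) (Fin n) ℚ) k b)
    (hik : g i k = (1 : Matrix (Fin n) (Fin n) ℚ) i k) (a b : Fin n) :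
    (theta i k q * g) a b = if a = i ∧ b = k then q else g a b := by
  rcases eq_or_ne i k with rfl | h
  · rw [theta_self_eq_diagonal, Matrix.diagonal_mul]
    by_cases ha : a = i
    · subst ha
      simp only [hrow, Matrix.one_apply]
      grind
    · simp [ha]
  · rw [theta_eq_transvection h]
    by_cases ha : a = i
    · subst ha
      rw [Matrix.transvection_mul_apply_same, hrow]
      by_cases hb : b = k
      · subst hb
        simp [hik, Matrix.one_apply_ne h]
      · simp [hb, Matrix.one_apply_ne (Ne.symm hb)]
    · rw [Matrix.transvection_mul_apply_of_ne _ _ _ _ ha]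
      simp [ha]

/-! ### Words of bounded length -/

/-- The matrix `M` is the product of at most `x` generators. -/
def HasWord {n : ℕ} (P : Finset Nat.Primes) (M : Matrix (Fin n) (Fin n) ℚ) (x : ℝ) : Prop :=
  ∃ l : List (GL (Fin n) ℚ), (∀ g ∈ l, g ∈ gens n P) ∧
    (l.prod : Matrix (Fin n) (Fin n) ℚ) = M ∧ (l.length : ℝ) ≤ x

namespace HasWord

variable {n : ℕ} {P : Finset Nat.Primes} {M N : Matrix (Fin n) (Fin n) ℚ} {x y : ℝ}

theorem mono (h : HasWord P M x) (hxy : x ≤ y) : HasWord P M y := by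
  obtain ⟨l, h1, h2, h3⟩ := h
  exact ⟨l, h1, h2, h3.trans hxy⟩

theorem one : HasWord P (1 : Matrix (Fin n) (Fin n) ℚ) 0 :=
  ⟨[], by simp, by simp, by simp⟩

theorem mul (hM : HasWord P M x) (hN : HasWord P N y) : HasWord P (M * N) (x + y) := by
  obtain ⟨l, h1, rfl, h3⟩ := hM
  obtain ⟨l', h1', rfl, h3'⟩ := hN
  refine ⟨l ++ l', fun g hg => ?_, by simp, ?_⟩
  · rcases List.mem_append.mp hg with h | h
    exacts [h1 g h, h1' g h]
  · rw [List.length_append, Nat.cast_add]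
    exact add_le_add h3 h3'

theorem inv (hM : HasWord P M x) : HasWord P M⁻¹ x := by
  obtain ⟨l, h1, rfl, h3⟩ := hM
  refine ⟨(l.map (·⁻¹)).reverse, fun g hg => ?_, ?_, by simpa using h3⟩
  · rw [List.mem_reverse, List.mem_map] at hg
    obtain ⟨g', hg', rfl⟩ := hg
    exact gens_inv (h1 g' hg')
  · rw [← List.prod_inv_reverse, Matrix.coe_units_inv]

theorem of_mem {g : GL (Fin n) ℚ} (hg : g ∈ gens n P) :
    HasWord P (g : Matrix (Fin n) (Fin n) ℚ) 1 :=
  ⟨[g], by simpa using hg, by simp, by simp⟩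

theorem theta_one {r s : Fin n} (h : r < s) : HasWord P (theta r s 1) 1 :=
  of_mem (g := thetaGL r s h.le 1 one_ne_zero) (Or.inl ⟨r, s, h, Or.inl rfl⟩)

theorem theta_prime (r : Fin n) {p : Nat.Primes} (hp : p ∈ P) :
    HasWord P (theta r r ((p : ℕ) : ℚ)) 1 :=
  of_mem (g := thetaGL r r le_rfl (p : ℕ) (prime_cast_ne_zero p)) (Or.inr ⟨r, p, hp, Or.inl rfl⟩)

theorem theta_prime_pow (r : Fin n) {p : Nat.Primes} (hp : p ∈ P) (k : ℕ) :
    HasWord P (theta r r (((p : ℕ) : ℚ) ^ k)) k := by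
  induction k with
  | zero => simpa [theta_self_one] using one
  | succ k ih =>
    rw [pow_succ, ← theta_self_mul_theta_self]
    simpa using ih.mul (theta_prime r hp)

theorem theta_natCast {r s : Fin n} (h : r < s) (a : ℕ) : HasWord P (theta r s (a : ℚ)) a := by
  induction a with
  | zero => simpa [theta_zero h.ne] using one
  | succ a ih =>
    rw [Nat.cast_succ, ← theta_mul_theta h.ne]
    simpa using ih.mul (theta_one h)

/-- Horner's scheme in base `p`. -/
theorem theta_mul_theta_prime_pow {r s : Fin n} (h : r < s) {p : Nat.Primes} (hp : p ∈ P)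
    (k : ℕ) : ∀ a : ℕ, a < (p : ℕ) ^ k →
      HasWord P (theta r s (a : ℚ) * theta r r (((p : ℕ) : ℚ) ^ k)) ((p : ℕ) * k) := by
  induction k with
  | zero =>
    intro a ha
    rw [pow_zero, Nat.lt_one_iff] at ha
    subst ha
    simpa [theta_zero h.ne, theta_self_one] using one
  | succ k ih =>
    intro a ha
    have hpos : 0 < (p : ℕ) := p.2.pos
    have hdiv : a / (p : ℕ) < (p : ℕ) ^ k := by
      rw [Nat.div_lt_iff_lt_mul hpos, ← pow_succ]
      exact ha
    have hmod : ((a % (p : ℕ) : ℕ) : ℝ) + 1 ≤ (p : ℕ) := by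
      exact_mod_cast Nat.mod_lt a hpos
    have ha' : (a : ℚ) = (a % (p : ℕ) : ℕ) + (p : ℕ) * (a / (p : ℕ) : ℕ) := by
      exact_mod_cast (Nat.mod_add_div a p).symm
    -- The last digit costs at most `p - 1` unipotent letters and the shift one diagonal letter,
    -- hence `p` letters per digit. The diagonal power stays on the right, to be cancelled only once
    -- at the end.
    have hw := (theta_natCast (P := P) h (a % (p : ℕ))).mul
      ((theta_prime r hp).mul (ih _ hdiv))
    rw [← mul_assoc (theta r r _), theta_self_mul_theta h.ne, mul_assoc, theta_self_mul_theta_self,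
      ← mul_assoc, theta_mul_theta h.ne, ← ha', ← pow_succ'] at hw
    refine hw.mono ?_
    push_cast
    linarith

/-- With `k` digits, Horner's scheme costs `p * k` and cancelling `θ_{rr}(p^k)` another `k`. As `p ≥
2`, the digit count is bounded through base 2; `a = 0` fits because `Real.log 0 = 0`. -/
theorem theta_natCast_log {r s : Fin n} (h : r < s) {p : Nat.Primes} (hp : p ∈ P) (a : ℕ) :
    HasWord P (theta r s (a : ℚ)) (((p : ℕ) + 1) * (Real.log a / Real.log 2 + 1)) := by
  set k := Nat.log p a + 1 with hk
  have hne : ((p : ℕ) : ℚ) ^ k ≠ 0 := pow_ne_zero _ (prime_cast_ne_zero p)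
  have hw := (theta_mul_theta_prime_pow h hp k a (Nat.lt_pow_succ_log_self p.2.one_lt a)).mul
    (theta_prime_pow r hp k).inv
  rw [theta_self_inv r hne, mul_assoc, theta_self_mul_theta_self, mul_inv_cancel₀ hne,
    theta_self_one, mul_one] at hw
  refine hw.mono ?_
  have hl2 : 0 < Real.log 2 := Real.log_pos one_lt_two
  have hlog : (Nat.log p a : ℝ) ≤ Real.log a / Real.log 2 := by
    rw [le_div_iff₀ hl2]
    rcases eq_or_ne a 0 with rfl | ha
    · simp
    rw [← Real.log_pow]
    refine Real.log_le_log (by positivity) ?_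
    exact_mod_cast (Nat.pow_le_pow_left p.2.two_le _).trans (Nat.pow_log_le_self p ha)
  have : (k : ℝ) ≤ Real.log a / Real.log 2 + 1 := by
    rw [hk]
    push_cast
    linarith
  nlinarith [(Nat.cast_nonneg (p : ℕ) : (0 : ℝ) ≤ (p : ℕ))]

theorem theta_intCast_log {r s : Fin n} (h : r < s) {p : Nat.Primes} (hp : p ∈ P) (a : ℤ) :
    HasWord P (theta r s (a : ℚ)) (((p : ℕ) + 1) * (Real.log a.natAbs / Real.log 2 + 1)) := by
  have hw := theta_natCast_log h hp a.natAbs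
  rcases Int.natAbs_eq a with ha | ha
  · have : (a : ℚ) = (a.natAbs : ℕ) := by
      rw [← Int.cast_natCast]
      exact congrArg _ ha
    rwa [this]
  · have : (a : ℚ) = -((a.natAbs : ℕ) : ℚ) := by exact_mod_cast ha
    rw [this, ← theta_inv h.ne]
    exact hw.inv

/-- One letter per prime factor; each factor is at least 2, so there are at most log₂ `d` of them.
-/
theorem theta_self_natCast (r : Fin n) {d : ℕ} (hd : d ≠ 0)
    (hP : ∀ p : Nat.Primes, (p : ℕ) ∣ d → p ∈ P) :
    HasWord P (theta r r (d : ℚ)) (Real.log d / Real.log 2) := by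
  induction d using induction_on_primes with
  | zero => exact absurd rfl hd
  | one => simpa [theta_self_one] using one
  | prime_mul p a hp ih =>
    have ha : a ≠ 0 := right_ne_zero_of_mul hd
    have hw := (theta_prime r (hP ⟨p, hp⟩ (dvd_mul_right p a))).mul
      (ih ha fun q hq => hP q (hq.mul_left p))
    rw [theta_self_mul_theta_self] at hw
    rw [Nat.cast_mul, Nat.cast_mul]
    refine hw.mono ?_
    have hl2 : 0 < Real.log 2 := Real.log_pos one_lt_two
    have h2 : Real.log 2 ≤ Real.log p :=
      Real.log_le_log two_pos (by exact_mod_cast hp.two_le)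
    rw [Real.log_mul (by exact_mod_cast hp.ne_zero) (by exact_mod_cast ha), add_div]
    gcongr
    rwa [one_le_div hl2]

end HasWord

/-! ### Entries of the elements of `FG n P` -/

/-- The subring `ℤ[1/P]` of the rational numbers. -/
def integersAway (P : Finset Nat.Primes) : Subring ℚ where
  carrier := {q | ∀ p : Nat.Primes, (p : ℕ) ∣ q.den → p ∈ P}
  mul_mem' {a b} ha hb p hp :=
    ((p.2.dvd_mul.mp (hp.trans (Rat.mul_den_dvd a b))).elim (ha p) (hb p))
  add_mem' {a b} ha hb p hp :=
    ((p.2.dvd_mul.mp (hp.trans (Rat.add_den_dvd a b))).elim (ha p) (hb p))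
  one_mem' p hp := absurd (Nat.dvd_one.mp hp) p.2.ne_one
  zero_mem' p hp := absurd (Nat.dvd_one.mp hp) p.2.ne_one
  neg_mem' {a} ha p hp := ha p (by rwa [Rat.neg_den] at hp)

theorem prime_inv_mem_integersAway {P : Finset Nat.Primes} {p : Nat.Primes} (hp : p ∈ P) :
    (((p : ℕ) : ℚ))⁻¹ ∈ integersAway P := by
  intro q hq
  rw [Rat.inv_natCast_den_of_pos p.2.pos, Nat.prime_dvd_prime_iff_eq q.2 p.2] at hq
  rwa [Subtype.ext hq]

/-- The upper triangular matrices over `ℤ[1/P]` whose diagonal entries are positive units. -/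
structure IsTriangular {n : ℕ} (P : Finset Nat.Primes) (f : Matrix (Fin n) (Fin n) ℚ) : Prop where
  mem : ∀ i j, f i j ∈ integersAway P
  eq_zero : ∀ i j, j < i → f i j = 0
  pos : ∀ i, 0 < f i i
  inv_mem : ∀ i, (f i i)⁻¹ ∈ integersAway P

namespace IsTriangular

variable {n : ℕ} {P : Finset Nat.Primes} {f g : Matrix (Fin n) (Fin n) ℚ}

theorem mul_apply_self (hf : IsTriangular P f) (hg : IsTriangular P g) (i : Fin n) :
    (f * g) i i = f i i * g i i := by
  rw [Matrix.mul_apply, Finset.sum_eq_single i]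
  · intro k _ hk
    rcases lt_or_gt_of_ne hk with h | h
    · rw [hf.eq_zero i k h, zero_mul]
    · rw [hg.eq_zero k i h, mul_zero]
  · simp

theorem mul (hf : IsTriangular P f) (hg : IsTriangular P g) : IsTriangular P (f * g) where
  mem i j := by
    rw [Matrix.mul_apply]
    exact Subring.sum_mem _ fun k _ => Subring.mul_mem _ (hf.mem i k) (hg.mem k j)
  eq_zero i j h := by
    rw [Matrix.mul_apply]
    refine Finset.sum_eq_zero fun k _ => ?_
    rcases lt_or_ge k i with hk | hk
    · rw [hf.eq_zero i k hk, zero_mul]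
    · rw [hg.eq_zero k j (h.trans_le hk), mul_zero]
  pos i := by
    rw [hf.mul_apply_self hg]
    exact mul_pos (hf.pos i) (hg.pos i)
  inv_mem i := by
    rw [hf.mul_apply_self hg, mul_inv]
    exact Subring.mul_mem _ (hf.inv_mem i) (hg.inv_mem i)

theorem theta {r s : Fin n} (h : r < s) {q : ℚ} (hq : q ∈ integersAway P) :
    IsTriangular P (theta r s q) where
  mem i j := by
    rw [theta_apply]
    split_ifs
    exacts [hq, one_mem _, zero_mem _]
  eq_zero i j hij := by
    rw [theta_apply, if_neg (by rintro ⟨rfl, rfl⟩; exact h.asymm hij), if_neg hij.ne']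
  pos i := by
    rw [theta_apply, if_neg (by rintro ⟨rfl, rfl⟩; exact h.ne rfl), if_pos rfl]
    exact one_pos
  inv_mem i := by
    rw [theta_apply, if_neg (by rintro ⟨rfl, rfl⟩; exact h.ne rfl), if_pos rfl, inv_one]
    exact one_mem _

theorem theta_self (r : Fin n) {q : ℚ} (hpos : 0 < q) (hq : q ∈ integersAway P)
    (hq' : q⁻¹ ∈ integersAway P) : IsTriangular P (AdelicWord.theta r r q) where
  mem i j := by
    rw [theta_apply]
    split_ifs
    exacts [hq, one_mem _, zero_mem _]
  eq_zero i j hij := by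
    rw [theta_apply, if_neg (by rintro ⟨rfl, rfl⟩; exact hij.ne rfl), if_neg hij.ne']
  pos i := by
    rw [theta_apply]
    split_ifs
    exacts [hpos, one_pos, absurd rfl ‹_›]
  inv_mem i := by
    rw [theta_apply]
    split_ifs
    exacts [hq', by simp, absurd rfl ‹_›]

theorem one : IsTriangular P (1 : Matrix (Fin n) (Fin n) ℚ) where
  mem i j := by
    rw [Matrix.one_apply]
    split_ifs
    exacts [one_mem _, zero_mem _]
  eq_zero i j h := Matrix.one_apply_ne h.ne'
  pos i := by simp
  inv_mem i := by simp

theorem of_mem_gens {g : GL (Fin n) ℚ} (hg : g ∈ gens n P) :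
    IsTriangular P (g : Matrix (Fin n) (Fin n) ℚ) := by
  rcases hg with ⟨r, s, h, rfl | rfl⟩ | ⟨r, p, hp, rfl | rfl⟩
  · exact theta h (one_mem _)
  · rw [Matrix.coe_units_inv, coe_thetaGL, theta_inv h.ne]
    exact theta h (neg_mem (one_mem _))
  · exact theta_self r (by exact_mod_cast p.2.pos) (natCast_mem _ _)
      (prime_inv_mem_integersAway hp)
  · rw [Matrix.coe_units_inv, coe_thetaGL, theta_self_inv r (prime_cast_ne_zero p)]
    refine theta_self r (inv_pos.mpr (by exact_mod_cast p.2.pos)) (prime_inv_mem_integersAway hp) ?_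
    rw [inv_inv]
    exact natCast_mem _ _

theorem of_list (l : List (GL (Fin n) ℚ)) (hl : ∀ g ∈ l, g ∈ gens n P) :
    IsTriangular P (l.prod : Matrix (Fin n) (Fin n) ℚ) := by
  induction l with
  | nil => exact one
  | cons g l ih =>
    rw [List.prod_cons, Units.val_mul]
    exact (of_mem_gens (hl g List.mem_cons_self)).mul
      (ih fun x hx => hl x (List.mem_cons_of_mem _ hx))

/-- Generators have the property and products preserve it. Positivity on the diagonal spares a
treatment of signs when diagonal entries are factored into primes. -/
theorem coe (f : FG n P) : IsTriangular P ((f : GL (Fin n) ℚ) : Matrix (Fin n) (Fin n) ℚ) := by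
  obtain ⟨l, hl, hprod⟩ := exists_word f
  rw [← hprod]
  exact of_list l hl

end IsTriangular

/-! ### The upper bound -/

namespace HasWord

variable {n : ℕ} {P : Finset Nat.Primes}

/-- With `d` the denominator, `θ_{rs}(q) = θ_{rr}(d)⁻¹ θ_{rs}(q.num) θ_{rr}(d)`; the two outer
factors account for the first summand. -/
theorem theta_ratCast {r s : Fin n} (h : r < s) {p : Nat.Primes} (hp : p ∈ P) {q : ℚ}
    (hq : q ∈ integersAway P) {A : ℝ} (hden : Real.log q.den ≤ A)
    (hnum : Real.log q.num.natAbs ≤ A) :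
    HasWord P (theta r s q) (2 * (A / Real.log 2) + ((p : ℕ) + 1) * (A / Real.log 2 + 1)) := by
  have hd : (q.den : ℚ) ≠ 0 := by exact_mod_cast q.den_nz
  have hl2 : 0 < Real.log 2 := Real.log_pos one_lt_two
  have hD := theta_self_natCast r q.den_nz hq
  have hw := hD.inv.mul ((theta_intCast_log h hp q.num).mul hD)
  rw [theta_self_inv r hd, ← mul_assoc, theta_self_mul_theta h.ne, mul_assoc,
    theta_self_mul_theta_self, inv_mul_cancel₀ hd, theta_self_one, mul_one, mul_comm,
    ← div_eq_mul_inv, Rat.num_div_den] at hw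
  refine hw.mono ?_
  have h1 : Real.log q.den / Real.log 2 ≤ A / Real.log 2 := by gcongr
  have h2 : ((p : ℕ) + 1 : ℝ) * (Real.log q.num.natAbs / Real.log 2 + 1) ≤
      ((p : ℕ) + 1) * (A / Real.log 2 + 1) := by gcongr
  linarith

theorem theta_self_ratCast (r : Fin n) {q : ℚ} (hpos : 0 < q) (hq : q ∈ integersAway P)
    (hq' : q⁻¹ ∈ integersAway P) {A : ℝ} (hden : Real.log q.den ≤ A)
    (hnum : Real.log q.num.natAbs ≤ A) :
    HasWord P (theta r r q) (2 * (A / Real.log 2)) := by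
  have hd : (q.den : ℚ) ≠ 0 := by exact_mod_cast q.den_nz
  have hl2 : 0 < Real.log 2 := Real.log_pos one_lt_two
  have hn0 : q.num.natAbs ≠ 0 := by simpa using hpos.ne'
  have hn : ((q.num.natAbs : ℕ) : ℚ) = q.num := by
    rw [← Int.cast_natCast, Int.natAbs_of_nonneg (Rat.num_pos.mpr hpos).le]
  -- The numerator is the denominator of `q⁻¹`, so its primes lie in `P` too.
  have hN := theta_self_natCast (P := P) r hn0 fun p hp => hq' p (by
    rwa [Rat.den_inv_of_ne_zero hpos.ne'])
  have hw := hN.mul (theta_self_natCast r q.den_nz hq).inv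
  rw [theta_self_inv r hd, theta_self_mul_theta_self, hn, ← div_eq_mul_inv,
    Rat.num_div_den] at hw
  refine hw.mono ?_
  have h1 : Real.log q.den / Real.log 2 ≤ A / Real.log 2 := by gcongr
  have h2 : Real.log q.num.natAbs / Real.log 2 ≤ A / Real.log 2 := by gcongr
  linarith

end HasWord

/-- The matrix that agrees with `f` at the first `t` positions, column by column, and with the
identity matrix at the others. -/
def fillColumns {n : ℕ} (f : Matrix (Fin n) (Fin n) ℚ) (t : ℕ) : Matrix (Fin n) (Fin n) ℚ :=
  Matrix.of fun a b => if (b : ℕ) * n + a < t then f a b else (1 : Matrix (Fin n) (Fin n) ℚ) a b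

theorem fillColumns_apply {n : ℕ} (f : Matrix (Fin n) (Fin n) ℚ) (t : ℕ) (a b : Fin n) :
    fillColumns f t a b =
      if (b : ℕ) * n + a < t then f a b else (1 : Matrix (Fin n) (Fin n) ℚ) a b := rfl

theorem eq_and_eq_of_mul_add_eq {n : ℕ} {a b i k : Fin n}
    (h : (b : ℕ) * n + a = (k : ℕ) * n + i) : a = i ∧ b = k := by
  have := (finProdFinEquiv (m := n) (n := n)).injective (a₁ := (b, a)) (a₂ := (k, i))
    (Fin.ext (by simp only [finProdFinEquiv_apply_val]; linarith))
  simp only [Prod.mk.injEq] at this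
  exact this.symm

theorem fillColumns_succ_of_lt {n : ℕ} {f : Matrix (Fin n) (Fin n) ℚ}
    (hf : ∀ i j, j < i → f i j = 0) {i k : Fin n} (hik : k < i) :
    fillColumns f ((k : ℕ) * n + i + 1) = fillColumns f ((k : ℕ) * n + i) := by
  ext a b
  rw [fillColumns_apply, fillColumns_apply]
  by_cases h : (b : ℕ) * n + a = (k : ℕ) * n + i
  · obtain ⟨rfl, rfl⟩ := eq_and_eq_of_mul_add_eq h
    simp [hf _ _ hik, Matrix.one_apply_ne hik.ne']
  · exact if_congr (by omega) rfl rfl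

/-- Row `k` is still a row of the identity: its entries in earlier columns lie below the diagonal,
where `f` vanishes, and `(k, k)` does not precede `(i, k)` in column `k`. Hence the multiplication
writes one entry and disturbs no other. -/
theorem fillColumns_succ_of_le {n : ℕ} {f : Matrix (Fin n) (Fin n) ℚ}
    (hf : ∀ i j, j < i → f i j = 0) {i k : Fin n} (hik : i ≤ k) :
    fillColumns f ((k : ℕ) * n + i + 1) =
      theta i k (f i k) * fillColumns f ((k : ℕ) * n + i) := by
  have hik' : (i : ℕ) ≤ k := hik
  ext a b
  rw [theta_mul_apply_of_row_eq_one]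
  · rw [fillColumns_apply, fillColumns_apply]
    by_cases h : (b : ℕ) * n + a = (k : ℕ) * n + i
    · obtain ⟨rfl, rfl⟩ := eq_and_eq_of_mul_add_eq h
      simp
    · rw [if_neg (c := a = i ∧ b = k) (by rintro ⟨rfl, rfl⟩; exact h rfl)]
      exact if_congr (by omega) rfl rfl
  · intro c
    rw [fillColumns_apply]
    split_ifs with h
    · have hck : c < k := by
        by_contra hle
        have : (k : ℕ) * n ≤ (c : ℕ) * n := Nat.mul_le_mul_right _ (not_lt.mp hle)
        omega
      rw [hf _ _ hck, Matrix.one_apply_ne hck.ne']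
    · rfl
  · rw [fillColumns_apply, if_neg (lt_irrefl _)]

theorem HasWord.of_entries {n : ℕ} {P : Finset Nat.Primes} {f : Matrix (Fin n) (Fin n) ℚ} {B : ℝ}
    (hB : 0 ≤ B) (hf : ∀ i j, j < i → f i j = 0)
    (h : ∀ i k, i ≤ k → HasWord P (theta i k (f i k)) B) : HasWord P f ((n * n : ℕ) * B) := by
  have key : ∀ t : ℕ, t ≤ n * n → HasWord P (fillColumns f t) (t * B) := by
    intro t
    induction t with
    | zero =>
      intro _
      have : fillColumns f 0 = 1 := by
        ext a b
        simp [fillColumns_apply]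
      simpa [this] using HasWord.one
    | succ t ih =>
      intro ht
      have hw := ih (by omega)
      -- Decodes `t` as row `i` of column `k`; positions below the diagonal cost nothing.
      obtain ⟨⟨k, i⟩, hki⟩ := finProdFinEquiv.surjective (⟨t, ht⟩ : Fin (n * n))
      have htki : t = (k : ℕ) * n + i := by
        have := congrArg Fin.val hki
        simp only [finProdFinEquiv_apply_val] at this
        linarith
      rcases lt_or_ge k i with hlt | hle
      · have : fillColumns f (t + 1) = fillColumns f t := by
          rw [htki]
          exact fillColumns_succ_of_lt hf hlt
        rw [this]
        exact hw.mono (by push_cast; linarith)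
      · have : fillColumns f (t + 1) = theta i k (f i k) * fillColumns f t := by
          rw [htki]
          exact fillColumns_succ_of_le hf hle
        rw [this]
        exact ((h i k hle).mul hw).mono (by push_cast; linarith)
  have hfull : fillColumns f (n * n) = f := by
    ext a b
    rw [fillColumns_apply, if_pos]
    calc (b : ℕ) * n + a < b * n + n := by omega
      _ = (b + 1) * n := by ring
      _ ≤ n * n := Nat.mul_le_mul_right _ b.2
  simpa only [hfull] using key (n * n) le_rfl

theorem wordLength_le_of_hasWord {n : ℕ} {P : Finset Nat.Primes} (f : FG n P) {x : ℝ}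
    (h : HasWord P ((f : GL (Fin n) ℚ) : Matrix (Fin n) (Fin n) ℚ) x) : (wordLength f : ℝ) ≤ x := by
  obtain ⟨l, hl, hprod, hlen⟩ := h
  have h1 : wordLength f ≤ l.length := Nat.sInf_le ⟨l, hl, Units.ext hprod, rfl⟩
  exact le_trans (by exact_mod_cast h1) hlen

theorem wordLength_le {n : ℕ} {P : Finset Nat.Primes} {p : Nat.Primes} (hp : p ∈ P) (f : FG n P) :
    (wordLength f : ℝ) ≤ (n * n : ℕ) *
      (2 * (adelicLength (f : GL (Fin n) ℚ) / Real.log 2) +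
        ((p : ℕ) + 1) * (adelicLength (f : GL (Fin n) ℚ) / Real.log 2 + 1)) := by
  have hl2 : 0 < Real.log 2 := Real.log_pos one_lt_two
  have hA := adelicLength_nonneg (f : GL (Fin n) ℚ)
  have ht := IsTriangular.coe f
  refine wordLength_le_of_hasWord f
    (HasWord.of_entries (by positivity) ht.eq_zero fun i k hik => ?_)
  have hden := log_den_le_adelicLength (f : GL (Fin n) ℚ) i k
  have hnum := log_natAbs_num_le_adelicLength (f : GL (Fin n) ℚ) i k
  rcases hik.lt_or_eq with hlt | rfl
  · exact HasWord.theta_ratCast hlt hp (ht.mem i k) hden hnum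
  · exact (HasWord.theta_self_ratCast i (ht.pos i) (ht.mem i i) (ht.inv_mem i) hden hnum).mono
      (le_add_of_nonneg_right (by positivity))

end AdelicWord

theorem mainTheorem2 (n : ℕ) (P : Finset Nat.Primes) (hP : P.Nonempty) :
    ∃ Q R S T : ℝ, 0 < Q ∧ 0 < R ∧ 0 < S ∧ 0 < T ∧
      ∀ f : AdelicWord.FG n P,
        (f ≠ 1 →
          Q + R * AdelicWord.adelicLength (f : GL (Fin n) ℚ) ≤ (AdelicWord.wordLength f : ℝ)) ∧
        (AdelicWord.wordLength f : ℝ) ≤ S + T * AdelicWord.adelicLength (f : GL (Fin n) ℚ) := by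
  obtain ⟨p, hp⟩ := hP
  obtain ⟨C, hC, hlower⟩ := AdelicWord.exists_adelicLength_le_mul_wordLength n P
  have hl2 : 0 < Real.log 2 := Real.log_pos one_lt_two
  -- Half of a word length that is at least 1 pays for `Q`, the other half for `R`. The summands `+
  -- 1` keep `S` and `T` positive when `n = 0`.
  refine ⟨1 / 2, 1 / (2 * C), (n * n : ℕ) * ((p : ℕ) + 1) + 1,
    (n * n : ℕ) * (((p : ℕ) + 3) / Real.log 2) + 1, by positivity, by positivity, by positivity,
    by positivity, fun f => ⟨fun hf => ?_, ?_⟩⟩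
  · obtain ⟨h1, h2⟩ := hlower f hf
    have h3 : 1 / (2 * C) * AdelicWord.adelicLength (f : GL (Fin n) ℚ) ≤
        1 / (2 * C) * (C * AdelicWord.wordLength f) := by gcongr
    have h4 : 1 / (2 * C) * (C * (AdelicWord.wordLength f : ℝ)) =
        AdelicWord.wordLength f / 2 := by field_simp
    linarith
  · have hA := AdelicWord.adelicLength_nonneg (f : GL (Fin n) ℚ)
    refine (AdelicWord.wordLength_le hp f).trans (le_of_sub_nonneg ?_)
    have : ∀ A : ℝ, (n * n : ℕ) * ((p : ℕ) + 1) + 1 +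
        ((n * n : ℕ) * (((p : ℕ) + 3) / Real.log 2) + 1) * A - (n * n : ℕ) *
          (2 * (A / Real.log 2) + ((p : ℕ) + 1) * (A / Real.log 2 + 1)) = 1 + A := by
      intro A
      field_simp
      ring
    rw [this]
    positivity
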